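/- Let $g>0$. For a $1$-periodic smooth $f:\mathbb R\to\mathbb R$ consider the bouncing map $P_f:(t_0,v_0)\mapsto(t_1,v_1)$, $$t_1=t_0+\tfrac2g v_0-\tfrac2g f[t_1,t_0],\qquad v_1=v_0+2\dot f(t_1)-2f[t_1,t_0],\qquad f[t_1,t_0]=\frac{f(t_1)-f(t_0)}{t_1-t_0},$$ where $t_1$ is the solution with $t_1\ge t_0+1$ of the first equation, which is unique when $v_0>\bar v$ for $\bar v$ sufficiently large. As $f$ is periodic, $P_f$ is regarded as a map on the half cylinder $\mathbb T\times(\bar v,+\infty)$, $\mathbb T=\mathbb R/\mathbb Z$. A positive orbit $(t_n,v_n)_{n\ge 0}$ of $P_f$ (with $v_n>\bar v$ for all $n$) is called unbounded if $v_n\to+\infty$. For $s\in\mathbb R$ let $$p_s(t)=a_1(s)\sin(2\pi t)+b_1(s)\cos(2\pi t)+a_2(s)\sin(4\pi t)+b_2(s)\cos(4\pi t),$$ $$a_1(s)=gs,\quad b_1(s)=g\Big((2-\sqrt3)s+\tfrac{4\sqrt3-7}{4\pi}\Big),\quad a_2(s)=g\Big(\tfrac{5}{96\pi}-\tfrac s2\Big),\quad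 b_2(s)=g\Big(\tfrac{\sqrt3}{2}s+\tfrac{48-29\sqrt3}{96\pi}\Big).$$ There exist bounded open intervals $I\ni 0.006$ with $0\notin I$ and $\max\dot p_s<g/4$ for all $s\in I$. For every such $I$ there is a nonempty open interval $\tilde I\subset I$ such that, for every sufficiently large $\bar v$, all maps $P_{p_s}$, $s\in I$, are well defined for $v>\bar v$ and the following holds for every sufficiently large positive integer $k$ (depending on $\bar v$). (i) There is a sequence $(t_n^*,v_n^*)_{n\ge0}$, independent of $s$, with $t_0^*=0$, $t_1^*=\frac5{12}+k$, $v_0^*=\frac g2(\frac5{12}+k)$, $t_{n+2}^*-t_n^*\in\mathbb N\setminus\{0\}$ and $v_{n+2}^*=v_n^*+\frac g2$ for all $n\ge0$, which is an unbounded orbit of $P_{p_s}$ for every $s\in I$. (ii) For every $s\in\tilde I$ there is a one-dimensional continuum $\tilde S_s\subset\mathbb T\times(\bar v,+\infty)$, namely an arc (a homeomorphic image of $[-1,1]$), such that every orbit of $P_{p_s}$ starting in $\tilde S_s$ is unbounded. All the continua $\tilde S_s$, $s\in\tilde I$, pass through the initial point $(t_0^*,v_0^*)$ of the common unbounded orbit,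 which is an interior point of each arc. -/

import Mathlib

open Set Filter Topology

noncomputable section

namespace BouncingBall

/-- `t₁` is an impact time following an impact at time `t₀` with outgoing velocity `v₀`: it solves
the implicit equation `t₁ = t₀ + (2/g) v₀ - (2/g) f[t₁, t₀]` and satisfies `t₁ ≥ t₀ + 1`
(this selects the relevant solution for large velocities).
Here `slope f t₀ t₁ = (f t₁ - f t₀) / (t₁ - t₀)` is the divided difference `f[t₁, t₀]`. -/
def IsNextImpact (g : ℝ) (f : ℝ → ℝ) (t₀ v₀ t₁ : ℝ) : Prop :=
  t₀ + 1 ≤ t₁ ∧ t₁ = t₀ + 2 / g * v₀ - 2 / g * slope f t₀ t₁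

/-- The bouncing map of the racket motion `f` is well defined on `{v > vbar}`: there the implicit
equation for the next impact time has exactly one solution. -/
def WellDefinedAbove (g : ℝ) (f : ℝ → ℝ) (vbar : ℝ) : Prop :=
  ∀ t v : ℝ, vbar < v → ∃! t₁ : ℝ, IsNextImpact g f t v t₁

/-- The next impact time `T(t₀, v₀)`. -/
def impactTime (g : ℝ) (f : ℝ → ℝ) (t₀ v₀ : ℝ) : ℝ :=
  Classical.epsilon (IsNextImpact g f t₀ v₀)

/-- The bouncing map `P_f : (t₀, v₀) ↦ (t₁, v₁)`, lifted to the plane, with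
`v₁ = v₀ + 2 f'(t₁) - 2 f[t₁, t₀]`. It is meaningful where it is well defined in the sense of
`WellDefinedAbove`. -/
def bounceMap (g : ℝ) (f : ℝ → ℝ) (z : ℝ × ℝ) : ℝ × ℝ :=
  (impactTime g f z.1 z.2,
    z.2 + 2 * deriv f (impactTime g f z.1 z.2) - 2 * slope f z.1 (impactTime g f z.1 z.2))

/-- The positive orbit of `z` under `P_f` is an unbounded bouncing motion: it stays for all times in
the domain `{v > vbar}` of the map, and its velocity tends to `+∞`. -/
def IsUnboundedMotion (g : ℝ) (f : ℝ → ℝ) (vbar : ℝ) (z : ℝ × ℝ) : Prop :=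
  (∀ n : ℕ, vbar < ((bounceMap g f)^[n] z).2) ∧
    Tendsto (fun n : ℕ => ((bounceMap g f)^[n] z).2) atTop atTop

/-- The family `p_s` of `1`-periodic trigonometric polynomials of degree `2`. -/
def family (g s : ℝ) (t : ℝ) : ℝ :=
  (g * s) * Real.sin (2 * Real.pi * t)
  + (g * ((2 - √3) * s + (4 * √3 - 7) / (4 * Real.pi))) * Real.cos (2 * Real.pi * t)
  + (g * (5 / (96 * Real.pi) - s / 2)) * Real.sin (4 * Real.pi * t)
  + (g * (√3 / 2 * s + (48 - 29 * √3) / (96 * Real.pi))) * Real.cos (4 * Real.pi * t)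

/-- `(a, b)` is an interval of parameters of the family: an open interval containing `0.006`,
not containing `0`, on which `max p_s' < g / 4`. (As `p_s'` is continuous and periodic, its maximum
is attained, so the bound on the maximum is the pointwise strict bound.) -/
def IsParameterInterval (g a b : ℝ) : Prop :=
  (0.006 : ℝ) ∈ Ioo a b ∧ (0 : ℝ) ∉ Ioo a b ∧
    ∀ s ∈ Ioo a b, ∀ t : ℝ, deriv (family g s) t < g / 4

/-- `S` is a one-dimensional continuum passing through `x`: an arc, that is a homeomorphic image of
the compact interval `[-1, 1]`, with `x` the image of the interior point `0`. -/
def IsArcThrough {X : Type*} [TopologicalSpace X] (S : Set X) (x : X) : Prop :=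
  ∃ γ : Icc (-1 : ℝ) 1 → X, IsEmbedding γ ∧ range γ = S ∧ γ ⟨0, by norm_num⟩ = x

end BouncingBall

end

/-!
The idea is to describe an orbit by its impact times `tₙ` alone. Eliminating the velocities
`vₙ = (g/2)(tₙ₊₁ - tₙ) + f[tₙ₊₁, tₙ]` turns the bouncing map into the second-order recurrence
`(g/2)(tₙ₊₂ - 2tₙ₊₁ + tₙ) = 2f'(tₙ₊₁) - f[tₙ₊₂, tₙ₊₁] - f[tₙ₊₁, tₙ]`, and any solution of it with
long enough steps that tend to infinity is an unbounded orbit (`IsRacket.orbit_of_recurrence`).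

*The common orbit.* The family is designed so that `f(0) = f(5/12)`, `f'(0) = 5g/24` and
`f'(5/12) = g/24` for every parameter (`isResonant_family`). If the impacts alternate between the
phases `0` and `5/12`, the divided differences vanish, and the recurrence prescribes the second
differences `1/6` and `5/6` alternately. Their mean is `1/2`, so that the steps grow; the explicit
solution is `refTime`.

*The arcs.* Write `tₙ = Tₙ + xₙ` with `Tₙ` the reference times. The recurrence becomes
`(2 + 4f''(Tₙ₊₁)/g) xₙ₊₁ = xₙ + xₙ₊₂ + …`, where the dots stand for a Taylor remainder of `f'` and
for divided differences over intervals of length at least `k - 1`; both have a small Lipschitz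
constant if the deviations are small and `k` is large. For `s ≤ 0.006` one has `f'' ≥ g/4` at both
nodes, hence the factor on the left is at least `3`, and the recurrence solved for `xₙ₊₁` is a
contraction in the supremum norm of the two neighbours and `xₙ₊₁` itself
(`IsRacket.deviationMap_contracting`). Banach's fixed point theorem in a space of bounded sequences
gives exactly one small bounded solution for each small `x₀`, and it is a Lipschitz function of
`x₀` (`exists_bounded_solution`, `abs_sub_le_of_recurrence`). The initial data of these solutions
form a graph over an interval of the circle, and `x₀ = 0` belongs to the common orbit. So
`Ĩ = (a, 0.006)` works when `I = (a, b)`.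

All estimates use one constant `K` bounding the derivatives of the whole family for parameters in
the bounded interval `I`, so that the thresholds for the velocity and for `k` do not depend on `s`.
-/

namespace BouncingBall

open scoped Real

/-! ### Bounded solutions of implicit second-order recurrences -/

/-- Two bounded solutions of a contracting recurrence `x (n+1) = G n (x n) (x (n+1)) (x (n+2))`
are nowhere further apart than at time `0`. -/
theorem abs_sub_le_of_recurrence {ρ κ : ℝ} (hκ : κ < 1) {G : ℕ → ℝ → ℝ → ℝ → ℝ}
    (hG : ∀ n a b c a' b' c' δ, |a| ≤ ρ → |b| ≤ ρ → |c| ≤ ρ → |a'| ≤ ρ → |b'| ≤ ρ → |c'| ≤ ρ →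
      |a - a'| ≤ δ → |b - b'| ≤ δ → |c - c'| ≤ δ → |G n a b c - G n a' b' c'| ≤ κ * δ)
    {x y : ℕ → ℝ} (hx : ∀ n, |x n| ≤ ρ) (hy : ∀ n, |y n| ≤ ρ)
    (hxG : ∀ n, x (n + 1) = G n (x n) (x (n + 1)) (x (n + 2)))
    (hyG : ∀ n, y (n + 1) = G n (y n) (y (n + 1)) (y (n + 2))) (n : ℕ) :
    |x n - y n| ≤ |x 0 - y 0| := by
  have hbdd : BddAbove (range fun n => |x n - y n|) := by
    refine ⟨ρ + ρ, ?_⟩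
    rintro _ ⟨n, rfl⟩
    exact (abs_sub _ _).trans (add_le_add (hx n) (hy n))
  set d := ⨆ n, |x n - y n| with hd
  have hle : ∀ n, |x n - y n| ≤ d := fun n => le_ciSup hbdd n
  have hd0 : 0 ≤ d := (abs_nonneg _).trans (hle 0)
  have hstep : d ≤ max |x 0 - y 0| (κ * d) := by
    refine ciSup_le fun n => ?_
    rcases n with _ | n
    · exact le_max_left _ _
    · refine le_trans ?_ (le_max_right _ _)
      rw [hxG n, hyG n]
      exact hG n _ _ _ _ _ _ d (hx _) (hx _) (hx _) (hy _) (hy _) (hy _) (hle _) (hle _) (hle _)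
  refine (hle n).trans ?_
  -- `d ≤ κ d` with `κ < 1` is only possible for `d = 0`.
  rcases le_max_iff.1 hstep with h | h
  · exact h
  · have : d = 0 := by nlinarith
    rw [this]; exact abs_nonneg _

/-- A contracting recurrence with the zero solution has a bounded solution for every small
initial value: the solutions are the fixed points of a contraction of a space of bounded
sequences. -/
theorem exists_bounded_solution {ρ κ : ℝ} (hκ0 : 0 ≤ κ) (hκ : κ < 1)
    {G : ℕ → ℝ → ℝ → ℝ → ℝ} (G0 : ∀ n, G n 0 0 0 = 0)
    (hG : ∀ n a b c a' b' c' δ, |a| ≤ ρ → |b| ≤ ρ → |c| ≤ ρ → |a'| ≤ ρ → |b'| ≤ ρ → |c'| ≤ ρ →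
      |a - a'| ≤ δ → |b - b'| ≤ δ → |c - c'| ≤ δ → |G n a b c - G n a' b' c'| ≤ κ * δ)
    {ξ : ℝ} (hξ : |ξ| ≤ ρ) :
    ∃ x : ℕ → ℝ, x 0 = ξ ∧ (∀ n, |x n| ≤ ρ) ∧
      ∀ n, x (n + 1) = G n (x n) (x (n + 1)) (x (n + 2)) := by
  have hρ : 0 ≤ ρ := (abs_nonneg _).trans hξ
  let s : Set (BoundedContinuousFunction ℕ ℝ) := {x | ∀ n, |x n| ≤ ρ}
  have hs : IsClosed s := by
    have : s = ⋂ n, {x : BoundedContinuousFunction ℕ ℝ | |x n| ≤ ρ} := by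
      ext x; simp [s]
    rw [this]
    exact isClosed_iInter fun n => isClosed_le
      (by fun_prop) continuous_const
  have : CompleteSpace s := hs.completeSpace_coe
  let F : (ℕ → ℝ) → ℕ → ℝ := fun x n => Nat.casesOn n ξ fun n => G n (x n) (x (n + 1)) (x (n + 2))
  have hF : ∀ x : s, ∀ n, |F x.1 n| ≤ ρ := by
    rintro ⟨x, hx⟩ n
    rcases n with _ | n
    · exact hξ
    · have h := hG n (x n) (x (n + 1)) (x (n + 2)) 0 0 0 ρ (hx _) (hx _) (hx _) (by simpa)
        (by simpa) (by simpa) (by simpa using hx n) (by simpa using hx (n + 1))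
        (by simpa using hx (n + 2))
      rw [G0, sub_zero] at h
      exact h.trans (mul_le_of_le_one_left hρ hκ.le)
  let Φ : s → s := fun x =>
    ⟨BoundedContinuousFunction.ofNormedAddCommGroup (F x.1) continuous_of_discreteTopology ρ
      fun n => hF x n, fun n => hF x n⟩
  have hΦ : ContractingWith ⟨κ, hκ0⟩ Φ := by
    refine ⟨by exact_mod_cast hκ, LipschitzWith.of_dist_le_mul fun x y => ?_⟩
    have hd : ∀ n, |x.1 n - y.1 n| ≤ dist x y := fun n =>
      BoundedContinuousFunction.dist_coe_le_dist (f := x.1) (g := y.1) n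
    refine (BoundedContinuousFunction.dist_le (by positivity)).2 fun n => ?_
    rcases n with _ | n
    · change dist ξ ξ ≤ _
      rw [dist_self]
      positivity
    · exact hG n _ _ _ _ _ _ _ (x.2 _) (x.2 _) (x.2 _) (y.2 _) (y.2 _) (y.2 _) (hd _) (hd _)
        (hd _)
  have : Nonempty s := ⟨⟨0, fun n => by simpa using hρ⟩⟩
  let x := ContractingWith.fixedPoint Φ hΦ
  have hx : Φ x = x := hΦ.fixedPoint_isFixedPt
  have hval : ∀ n, x.1 n = F x.1 n := fun n =>
    (congrArg (fun y : s => y.1 n) hx).symm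
  exact ⟨x.1, hval 0, x.2, fun n => hval (n + 1)⟩

/-! ### Racket motions -/

/-- The quantitative hypotheses on a racket motion `f`: it is `1`-periodic with derivatives
`f₁ = f'` and `f₂ = f''`, and `K` bounds `f`, `f'` and the Lipschitz constant of `f''`. -/
structure IsRacket (K : ℝ) (f f₁ f₂ : ℝ → ℝ) : Prop where
  periodic : Function.Periodic f 1
  periodic_deriv : Function.Periodic f₁ 1
  periodic_deriv₂ : Function.Periodic f₂ 1
  hasDerivAt : ∀ t, HasDerivAt f (f₁ t) t
  hasDerivAt₁ : ∀ t, HasDerivAt f₁ (f₂ t) t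
  abs_apply_le : ∀ t, |f t| ≤ K
  abs_deriv_le : ∀ t, |f₁ t| ≤ K
  lipschitz₂ : ∀ t u, |f₂ t - f₂ u| ≤ K * |t - u|

theorem abs_sub_le_of_hasDerivAt {f f' : ℝ → ℝ} {K : ℝ} (hf : ∀ t, HasDerivAt f (f' t) t)
    (hK : ∀ t, |f' t| ≤ K) (x y : ℝ) : |f x - f y| ≤ K * |x - y| :=
  convex_univ.norm_image_sub_le_of_norm_hasDerivWithin_le (fun t _ => (hf t).hasDerivWithinAt)
    (fun t _ => hK t) (mem_univ y) (mem_univ x)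

namespace IsRacket

variable {K : ℝ} {f f₁ f₂ : ℝ → ℝ}

theorem nonneg (h : IsRacket K f f₁ f₂) : 0 ≤ K := (abs_nonneg _).trans (h.abs_apply_le 0)

theorem lipschitz (h : IsRacket K f f₁ f₂) (x y : ℝ) : |f x - f y| ≤ K * |x - y| :=
  abs_sub_le_of_hasDerivAt h.hasDerivAt h.abs_deriv_le x y

theorem abs_slope_le (h : IsRacket K f f₁ f₂) (x y : ℝ) : |slope f x y| ≤ K := by
  rw [slope_def_field, abs_div]
  exact div_le_of_le_mul₀ (abs_nonneg _) h.nonneg (h.lipschitz y x)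

/-- Divided differences over long intervals depend on the end points with a small Lipschitz
constant. -/
theorem abs_slope_sub_slope_le (h : IsRacket K f f₁ f₂) {x y x' y' D δ : ℝ} (hD : 1 ≤ D)
    (hxy : D ≤ y - x) (hxy' : D ≤ y' - x') (hx : |x - x'| ≤ δ) (hy : |y - y'| ≤ δ) :
    |slope f x y - slope f x' y'| ≤ 6 * K / D * δ := by
  have hK := h.nonneg
  have hδ : 0 ≤ δ := (abs_nonneg _).trans hx
  have hp : 0 < y - x := by linarith
  have hp' : 0 < y' - x' := by linarith
  have hD0 : 0 < D := by linarith
  -- The numerator is varied first, then the denominator.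
  have e : slope f x y - slope f x' y' =
      ((f y - f y') - (f x - f x')) / (y - x)
        + slope f x' y' * (((x - x') - (y - y')) / (y - x)) := by
    simp only [slope_def_field]
    field_simp
    ring
  have h1 : |(f y - f y') - (f x - f x')| ≤ 2 * K * δ := by
    have a := (h.lipschitz y y').trans (mul_le_mul_of_nonneg_left hy hK)
    have b := (h.lipschitz x x').trans (mul_le_mul_of_nonneg_left hx hK)
    have := abs_sub (f y - f y') (f x - f x')
    linarith
  have h2 : |(x - x') - (y - y')| ≤ 2 * δ := by
    have := abs_sub (x - x') (y - y')
    linarith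
  have key : ∀ {u c : ℝ}, 0 ≤ c → |u| ≤ c → |u / (y - x)| ≤ c / D := by
    intro u c hc hu
    rw [abs_div, abs_of_pos hp]
    exact div_le_div₀ hc hu hD0 hxy
  have h3 := key (by positivity) h1
  have h4 := key (by positivity) h2
  rw [e]
  calc _ ≤ 2 * K * δ / D + K * (2 * δ / D) := by
        refine (abs_add_le _ _).trans (add_le_add h3 ?_)
        rw [abs_mul]
        exact mul_le_mul (h.abs_slope_le _ _) h4 (abs_nonneg _) hK
    _ = 4 * K / D * δ := by ring
    _ ≤ 6 * K / D * δ := by gcongr; norm_num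

/-- The Taylor remainder of `f'` has a small Lipschitz constant near the base point. -/
theorem abs_remainder_sub_le (h : IsRacket K f f₁ f₂) {T ρ b b' : ℝ} (hb : |b| ≤ ρ)
    (hb' : |b'| ≤ ρ) :
    |(f₁ (T + b) - f₁ T - f₂ T * b) - (f₁ (T + b') - f₁ T - f₂ T * b')| ≤
      K * ρ * |b - b'| := by
  have hder : ∀ u ∈ Icc (-ρ) ρ, HasDerivWithinAt (fun b => f₁ (T + b) - f₁ T - f₂ T * b)
      (f₂ (T + u) - f₂ T) (Icc (-ρ) ρ) u := by
    intro u _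
    have h1 : HasDerivAt (fun b => f₁ (T + b)) (f₂ (T + u)) u :=
      (h.hasDerivAt₁ (T + u)).comp_const_add T u
    have h2 : HasDerivAt (fun b => f₂ T * b) (f₂ T) u := by
      simpa using (hasDerivAt_id u).const_mul (f₂ T)
    exact ((h1.sub_const _).sub h2).hasDerivWithinAt
  refine (convex_Icc (-ρ) ρ).norm_image_sub_le_of_norm_hasDerivWithin_le hder (fun u hu => ?_)
    (abs_le.1 hb') (abs_le.1 hb)
  refine (h.lipschitz₂ _ _).trans (mul_le_mul_of_nonneg_left ?_ h.nonneg)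
  simpa using abs_le.2 hu

theorem slope_add_int (h : IsRacket K f f₁ f₂) (x y : ℝ) (m : ℤ) :
    slope f (x + m) (y + m) = slope f x y := by
  have e : ∀ t, f (t + m) = f t := by simpa using h.periodic.int_mul m
  simp only [slope_def_field, e, add_sub_add_right_eq_sub]

/-- Existence holds by the intermediate value theorem. The equation need not be monotone near
`t + 1`, but every solution is far from `t` when `v` is large, and there divided differences have a
Lipschitz constant too small for a second solution. -/
theorem wellDefinedAbove (h : IsRacket K f f₁ f₂) {g vbar : ℝ} (hg : 0 < g)
    (hv : g / 2 + 14 * K ≤ vbar) : WellDefinedAbove g f vbar := by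
  intro t v hvv
  have hK := h.nonneg
  have hKg : 0 ≤ K / g := by positivity
  have hvg : 1 + 28 * (K / g) ≤ 2 / g * v := by
    have : 2 / g * (g / 2 + 14 * K) = 1 + 28 * (K / g) := by
      field_simp
      ring
    rw [← this]
    gcongr
    linarith
  have hsl : ∀ u, |2 / g * slope f t u| ≤ 2 * (K / g) := by
    intro u
    rw [abs_mul, abs_of_pos (by positivity : 0 < 2 / g)]
    calc 2 / g * |slope f t u| ≤ 2 / g * K := by gcongr; exact h.abs_slope_le _ _
      _ = 2 * (K / g) := by ring
  have hcont : ContinuousOn (fun u => u - t + 2 / g * slope f t u) (Ici (t + 1)) := by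
    have hf : Continuous f := continuous_iff_continuousAt.2 fun x => (h.hasDerivAt x).continuousAt
    simp only [slope_def_field]
    refine ContinuousOn.add (by fun_prop) (continuousOn_const.mul
      (ContinuousOn.div (by fun_prop) (by fun_prop) fun u hu => ?_))
    have : t + 1 ≤ u := hu
    exact ne_of_gt (by linarith)
  obtain ⟨u, hu, hue⟩ : 2 / g * v ∈
      (fun u => u - t + 2 / g * slope f t u) '' Icc (t + 1) (t + 2 / g * v + 2 * (K / g)) := by
    refine intermediate_value_Icc (by linarith)
      (hcont.mono fun u hu => hu.1) ⟨?_, ?_⟩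
    · have := abs_le.1 (hsl (t + 1))
      linarith
    · have := abs_le.1 (hsl (t + 2 / g * v + 2 * (K / g)))
      linarith
  refine ⟨u, ⟨hu.1, by dsimp only at hue; linarith⟩, ?_⟩
  rintro u' ⟨-, hu'⟩
  dsimp only at hue
  have a := abs_le.1 (hsl u)
  have a' := abs_le.1 (hsl u')
  have hD : 1 ≤ 1 + 24 * (K / g) := by linarith
  have hlip := h.abs_slope_sub_slope_le hD (x := t) (x' := t) (y := u') (y' := u) (δ := |u' - u|)
    (by linarith) (by linarith) (by simp) le_rfl
  have e : u' - u = -(2 / g * (slope f t u' - slope f t u)) := by linear_combination hu' - hue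
  have h1 : |u' - u| ≤ 12 * (K / g) / (1 + 24 * (K / g)) * |u' - u| := by
    calc |u' - u| = 2 / g * |slope f t u' - slope f t u| := by
          conv_lhs => rw [e]
          rw [abs_neg, abs_mul, abs_of_pos (by positivity : 0 < 2 / g)]
      _ ≤ 2 / g * (6 * K / (1 + 24 * (K / g)) * |u' - u|) := by gcongr
      _ = _ := by ring
  have h2 : 12 * (K / g) / (1 + 24 * (K / g)) < 1 := by
    rw [div_lt_one (by linarith)]
    linarith
  have h3 : |u' - u| = 0 := by nlinarith [abs_nonneg (u' - u)]
  linarith [abs_eq_zero.1 h3]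

end IsRacket

/-! ### Orbits as sequences of impact times -/

/-- The velocity after the impact at time `t` for which the next impact is at time `u`. -/
noncomputable def launchVelocity (g : ℝ) (f : ℝ → ℝ) (t u : ℝ) : ℝ := g / 2 * (u - t) + slope f t u

/-- The sequence of impact times of an orbit satisfies a second-order recurrence; conversely a
solution with growing steps is an unbounded orbit. -/
theorem IsRacket.orbit_of_recurrence {K : ℝ} {f f₁ f₂ : ℝ → ℝ} (h : IsRacket K f f₁ f₂)
    {g vbar : ℝ} (hg : 0 < g) (hwd : WellDefinedAbove g f vbar) {t : ℕ → ℝ}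
    (hstep : ∀ n, t n + 1 ≤ t (n + 1)) (hv : ∀ n, vbar < g / 2 * (t (n + 1) - t n) - K)
    (hlim : Tendsto (fun n => t (n + 1) - t n) atTop atTop)
    (hrec : ∀ n, g / 2 * (t (n + 2) - 2 * t (n + 1) + t n) =
      2 * f₁ (t (n + 1)) - slope f (t (n + 1)) (t (n + 2)) - slope f (t n) (t (n + 1))) :
    (∀ n, (bounceMap g f)^[n] (t 0, launchVelocity g f (t 0) (t 1)) =
      (t n, launchVelocity g f (t n) (t (n + 1)))) ∧
    IsUnboundedMotion g f vbar (t 0, launchVelocity g f (t 0) (t 1)) := by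
  have hlow : ∀ n, g / 2 * (t (n + 1) - t n) - K ≤ launchVelocity g f (t n) (t (n + 1)) := by
    intro n
    have := abs_le.1 (h.abs_slope_le (t n) (t (n + 1)))
    unfold launchVelocity
    linarith
  have hv' : ∀ n, vbar < launchVelocity g f (t n) (t (n + 1)) := fun n =>
    (hv n).trans_le (hlow n)
  have hit : ∀ n, (bounceMap g f)^[n] (t 0, launchVelocity g f (t 0) (t 1)) =
      (t n, launchVelocity g f (t n) (t (n + 1))) := by
    intro n
    induction n with
    | zero => rfl
    | succ n ih =>
      rw [Function.iterate_succ_apply', ih]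
      have hnext : IsNextImpact g f (t n) (launchVelocity g f (t n) (t (n + 1))) (t (n + 1)) := by
        refine ⟨hstep n, ?_⟩
        unfold launchVelocity
        field_simp
        ring
      have himp : impactTime g f (t n) (launchVelocity g f (t n) (t (n + 1))) = t (n + 1) :=
        (hwd _ _ (hv' n)).unique (Classical.epsilon_spec ⟨_, hnext⟩) hnext
      simp only [bounceMap, himp, (h.hasDerivAt _).deriv]
      refine Prod.ext rfl ?_
      unfold launchVelocity
      linear_combination -(hrec n)
  refine ⟨hit, fun n => by rw [hit]; exact hv' n, ?_⟩
  simp only [hit]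
  refine tendsto_atTop_mono hlow ?_
  exact tendsto_atTop_add_const_right _ _ (hlim.const_mul_atTop (by positivity))

/-! ### The common orbit -/

/-- The impact times of the common orbit: integers at even steps, `5/12` plus integers at odd
steps. -/
noncomputable def refTime (k n : ℕ) : ℝ := (n : ℝ) ^ 2 / 4 + k * n + (1 - (-1) ^ n) / 12

theorem refTime_zero (k : ℕ) : refTime k 0 = 0 := by simp [refTime]

theorem refTime_one (k : ℕ) : refTime k 1 = 5 / 12 + k := by
  simp only [refTime]
  push_cast
  ring

theorem refTime_even (k j : ℕ) : ∃ m : ℤ, refTime k (2 * j) = 0 + m := by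
  refine ⟨j ^ 2 + 2 * k * j, ?_⟩
  simp only [refTime, pow_mul]
  push_cast
  norm_num
  ring

theorem refTime_odd (k j : ℕ) : ∃ m : ℤ, refTime k (2 * j + 1) = 5 / 12 + m := by
  refine ⟨j ^ 2 + j + 2 * k * j + k, ?_⟩
  simp only [refTime, pow_mul, pow_succ]
  push_cast
  norm_num
  ring

theorem periodic_refTime_even {f : ℝ → ℝ} (hf : Function.Periodic f 1) (k j : ℕ) :
    f (refTime k (2 * j)) = f 0 := by
  obtain ⟨m, hm⟩ := refTime_even k j
  rw [hm]
  simpa using hf.int_mul m 0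

theorem periodic_refTime_odd {f : ℝ → ℝ} (hf : Function.Periodic f 1) (k j : ℕ) :
    f (refTime k (2 * j + 1)) = f (5 / 12) := by
  obtain ⟨m, hm⟩ := refTime_odd k j
  rw [hm]
  simpa using hf.int_mul m (5 / 12)

theorem refTime_step (k n : ℕ) : (k : ℝ) + n / 2 ≤ refTime k (n + 1) - refTime k n := by
  simp only [refTime, pow_succ]
  push_cast
  rcases neg_one_pow_eq_or ℝ n with e | e <;> rw [e] <;> nlinarith

theorem refTime_add_two (k n : ℕ) :
    refTime k (n + 2) = refTime k n + ((n + 1 + 2 * k : ℕ) : ℝ) := by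
  simp only [refTime, pow_add]
  push_cast
  ring

/-- The values at the nodes `0` and `5/12` for which the reference times are impact times. -/
structure IsResonant (g : ℝ) (f f₁ : ℝ → ℝ) : Prop where
  node_eq : f (5 / 12) = f 0
  deriv_zero : f₁ 0 = 5 * g / 24
  deriv_node : f₁ (5 / 12) = g / 24

theorem IsRacket.map_refTime {K g : ℝ} {f f₁ f₂ : ℝ → ℝ} (h : IsRacket K f f₁ f₂)
    (hr : IsResonant g f f₁) (k n : ℕ) : f (refTime k n) = f 0 := by
  rcases Nat.even_or_odd' n with ⟨j, rfl | rfl⟩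
  · exact periodic_refTime_even h.periodic k j
  · rw [periodic_refTime_odd h.periodic, hr.node_eq]

theorem IsRacket.slope_refTime {K g : ℝ} {f f₁ f₂ : ℝ → ℝ} (h : IsRacket K f f₁ f₂)
    (hr : IsResonant g f f₁) (k n m : ℕ) : slope f (refTime k n) (refTime k m) = 0 := by
  rw [slope_def_field, h.map_refTime hr, h.map_refTime hr, sub_self, zero_div]

/-- The reference times solve the recurrence for impact times, in which the divided differences
vanish. -/
theorem IsRacket.refTime_recurrence {K g : ℝ} {f f₁ f₂ : ℝ → ℝ} (h : IsRacket K f f₁ f₂)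
    (hr : IsResonant g f f₁) (k n : ℕ) :
    g / 2 * (refTime k (n + 2) - 2 * refTime k (n + 1) + refTime k n) =
      2 * f₁ (refTime k (n + 1)) := by
  rcases Nat.even_or_odd' n with ⟨j, rfl | rfl⟩
  · rw [periodic_refTime_odd h.periodic_deriv, hr.deriv_node]
    simp only [refTime, pow_succ, pow_mul]
    push_cast
    norm_num
    ring
  · rw [show f₁ (refTime k (2 * j + 1 + 1)) = f₁ 0 from
      periodic_refTime_even h.periodic_deriv k (j + 1), hr.deriv_zero]
    simp only [refTime, pow_succ, pow_mul]
    push_cast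
    norm_num
    ring

theorem IsRacket.le_deriv₂_refTime {K c : ℝ} {f f₁ f₂ : ℝ → ℝ} (h : IsRacket K f f₁ f₂)
    (h0 : c ≤ f₂ 0) (h1 : c ≤ f₂ (5 / 12)) (k n : ℕ) : c ≤ f₂ (refTime k n) := by
  rcases Nat.even_or_odd' n with ⟨j, rfl | rfl⟩
  · rwa [periodic_refTime_even h.periodic_deriv₂]
  · rwa [periodic_refTime_odd h.periodic_deriv₂]

/-! ### Perturbing the common orbit -/

/-- The recurrence for the deviations from the reference times, solved for the middle deviation.
Dividing by `2 + 4 f''(T) / g` makes it contracting when `f''` is positive at the nodes. -/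
noncomputable def deviationMap (g : ℝ) (f f₁ f₂ : ℝ → ℝ) (k n : ℕ) (a b c : ℝ) : ℝ :=
  (a + c - 4 / g * (f₁ (refTime k (n + 1) + b) - f₁ (refTime k (n + 1))
      - f₂ (refTime k (n + 1)) * b)
    + 2 / g * (slope f (refTime k n + a) (refTime k (n + 1) + b)
      + slope f (refTime k (n + 1) + b) (refTime k (n + 2) + c)))
  / (2 + 4 / g * f₂ (refTime k (n + 1)))

section Deviation

variable {g K ρ : ℝ} {f f₁ f₂ : ℝ → ℝ} {k : ℕ}

theorem IsRacket.deviationMap_zero (h : IsRacket K f f₁ f₂) (hr : IsResonant g f f₁) (n : ℕ) :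
    deviationMap g f f₁ f₂ k n 0 0 0 = 0 := by
  simp [deviationMap, h.slope_refTime hr]

/-- The numerator has the Lipschitz constant `2 + 1/4 + 1/8 + 1/8 = 5/2`, where `1/4` is due to the
Taylor remainder and `1/8` to each divided difference; the denominator is at least `3`. -/
theorem IsRacket.deviationMap_contracting (h : IsRacket K f f₁ f₂) (hg : 0 < g)
    (h0 : g / 4 ≤ f₂ 0) (h1 : g / 4 ≤ f₂ (5 / 12)) (hρ : ρ ≤ 1 / 4) (hρK : 16 * K * ρ ≤ g)
    (hk : 2 ≤ k) (hkK : 96 * K ≤ g * (k - 1)) (n : ℕ) (a b c a' b' c' δ : ℝ)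
    (ha : |a| ≤ ρ) (hb : |b| ≤ ρ) (hc : |c| ≤ ρ) (ha' : |a'| ≤ ρ) (hb' : |b'| ≤ ρ)
    (hc' : |c'| ≤ ρ) (hda : |a - a'| ≤ δ) (hdb : |b - b'| ≤ δ) (hdc : |c - c'| ≤ δ) :
    |deviationMap g f f₁ f₂ k n a b c - deviationMap g f f₁ f₂ k n a' b' c'| ≤ 5 / 6 * δ := by
  have hK := h.nonneg
  have hδ : 0 ≤ δ := (abs_nonneg _).trans hda
  have hρ0 : 0 ≤ ρ := (abs_nonneg _).trans ha
  have hk' : (2 : ℝ) ≤ k := by exact_mod_cast hk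
  have hD : (1 : ℝ) ≤ k - 1 := by linarith
  have hgap : ∀ m {x y : ℝ}, |x| ≤ ρ → |y| ≤ ρ →
      (k : ℝ) - 1 ≤ refTime k (m + 1) + y - (refTime k m + x) := by
    intro m x y hx hy
    have := refTime_step k m
    have := abs_le.1 hx
    have := abs_le.1 hy
    have : (0 : ℝ) ≤ m := m.cast_nonneg
    linarith
  have s1 := h.abs_slope_sub_slope_le hD (hgap n ha hb) (hgap n ha' hb') (δ := δ)
    (by simpa using hda) (by simpa using hdb)
  have s2 := h.abs_slope_sub_slope_le hD (hgap (n + 1) hb hc) (hgap (n + 1) hb' hc') (δ := δ)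
    (by simpa using hdb) (by simpa using hdc)
  have r := (h.abs_remainder_sub_le (T := refTime k (n + 1)) hb hb').trans
    (mul_le_mul_of_nonneg_left hdb (by positivity))
  have hf₂ := h.le_deriv₂_refTime h0 h1 k (n + 1)
  have hden : 3 ≤ 2 + 4 / g * f₂ (refTime k (n + 1)) := by
    have : 4 / g * (g / 4) ≤ 4 / g * f₂ (refTime k (n + 1)) := by gcongr
    have e : 4 / g * (g / 4) = 1 := by field_simp
    linarith
  have c1 : 4 / g * (K * ρ * δ) ≤ 1 / 4 * δ := by
    have : 4 / g * (K * ρ) ≤ 1 / 4 := by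
      rw [div_mul_eq_mul_div, div_le_iff₀ hg]
      linarith
    nlinarith
  have c2 : 2 / g * (6 * K / (k - 1) * δ) ≤ 1 / 8 * δ := by
    have : 2 / g * (6 * K / (k - 1)) ≤ 1 / 8 := by
      rw [div_mul_div_comm, div_le_iff₀ (by nlinarith)]
      linarith
    nlinarith
  unfold deviationMap
  generalize refTime k (n + 1) = T at *
  rw [← sub_div, abs_div, abs_of_pos (by linarith : 0 < 2 + 4 / g * f₂ T)]
  rw [div_le_iff₀ (by linarith)]
  have r' : |4 / g * ((f₁ (T + b) - f₁ T - f₂ T * b) - (f₁ (T + b') - f₁ T - f₂ T * b'))| ≤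
      1 / 4 * δ := by
    rw [abs_mul, abs_of_pos (by positivity : 0 < 4 / g)]
    exact (mul_le_mul_of_nonneg_left r (by positivity)).trans c1
  have key : ∀ {u : ℝ}, |u| ≤ 6 * K / (k - 1) * δ → |2 / g * u| ≤ 1 / 8 * δ := by
    intro u hu
    rw [abs_mul, abs_of_pos (by positivity : 0 < 2 / g)]
    exact (mul_le_mul_of_nonneg_left hu (by positivity)).trans c2
  have s1' := abs_le.1 (key s1)
  have s2' := abs_le.1 (key s2)
  have r'' := abs_le.1 r'
  have := abs_le.1 hda
  have := abs_le.1 hdc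
  have hR : 5 / 2 * δ ≤ 5 / 6 * δ * (2 + 4 / g * f₂ T) := by nlinarith
  refine le_trans (abs_le.2 ⟨?_, ?_⟩) hR <;> linarith

/-- A solution of the deviation recurrence gives impact times of an orbit. -/
theorem IsRacket.recurrence_of_deviation (h : IsRacket K f f₁ f₂) (hg : 0 < g)
    (hr : IsResonant g f f₁) (h0 : g / 4 ≤ f₂ 0) (h1 : g / 4 ≤ f₂ (5 / 12)) {n : ℕ}
    {a b c : ℝ} (hb : b = deviationMap g f f₁ f₂ k n a b c) :
    g / 2 * ((refTime k (n + 2) + c) - 2 * (refTime k (n + 1) + b) + (refTime k n + a)) =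
      2 * f₁ (refTime k (n + 1) + b)
        - slope f (refTime k (n + 1) + b) (refTime k (n + 2) + c)
        - slope f (refTime k n + a) (refTime k (n + 1) + b) := by
  have hf₂ := h.le_deriv₂_refTime h0 h1 k (n + 1)
  have hden : 0 < 2 + 4 / g * f₂ (refTime k (n + 1)) := by
    have : 0 ≤ 4 / g * f₂ (refTime k (n + 1)) := mul_nonneg (by positivity) (by linarith)
    linarith
  have href := h.refTime_recurrence hr k n
  rw [deviationMap, eq_div_iff hden.ne'] at hb
  generalize slope f (refTime k (n + 1) + b) (refTime k (n + 2) + c) = S₁ at *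
  generalize slope f (refTime k n + a) (refTime k (n + 1) + b) = S₂ at *
  field_simp at hb
  linarith

/-- Offsetting the reference times by bounded deviations and an integer gives an unbounded orbit
as soon as the second-order recurrence holds. -/
theorem IsRacket.orbit_of_deviation (h : IsRacket K f f₁ f₂) (hg : 0 < g) {vbar : ℝ}
    (hv₀ : g / 2 + 14 * K ≤ vbar) (hρ : ρ ≤ 1 / 4) (hkv : 2 * (vbar + K) < g * (k - 1))
    {x : ℕ → ℝ} (hx : ∀ n, |x n| ≤ ρ) (m : ℤ)
    (hrec : ∀ n, g / 2 * ((refTime k (n + 2) + x (n + 2)) - 2 * (refTime k (n + 1) + x (n + 1))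
        + (refTime k n + x n)) =
      2 * f₁ (refTime k (n + 1) + x (n + 1))
        - slope f (refTime k (n + 1) + x (n + 1)) (refTime k (n + 2) + x (n + 2))
        - slope f (refTime k n + x n) (refTime k (n + 1) + x (n + 1))) :
    let v := fun n => launchVelocity g f (refTime k n + x n) (refTime k (n + 1) + x (n + 1))
    (∀ n, (bounceMap g f)^[n] (refTime k 0 + x 0 + m, v 0) = (refTime k n + x n + m, v n)) ∧
    IsUnboundedMotion g f vbar (refTime k 0 + x 0 + m, v 0) := by
  have hK := h.nonneg
  have hk1 : (1 : ℝ) ≤ k - 1 := by nlinarith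
  have hgap : ∀ n : ℕ, (k : ℝ) - 1 + n / 2 ≤
      (refTime k (n + 1) + x (n + 1) + m) - (refTime k n + x n + m) := by
    intro n
    have := refTime_step k n
    have := abs_le.1 (hx n)
    have := abs_le.1 (hx (n + 1))
    linarith
  have hn0 : ∀ n : ℕ, (0 : ℝ) ≤ n := fun n => n.cast_nonneg
  have key := h.orbit_of_recurrence hg (h.wellDefinedAbove hg hv₀)
    (t := fun n => refTime k n + x n + m)
    (fun n => by have := hgap n; have := hn0 n; linarith)
    (fun n => by
      have : g * (k - 1) ≤
          g * ((refTime k (n + 1) + x (n + 1) + m) - (refTime k n + x n + m)) :=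
        mul_le_mul_of_nonneg_left (by have := hgap n; have := hn0 n; linarith) hg.le
      linarith)
    (tendsto_atTop_mono hgap (tendsto_atTop_add_const_left _ _
      (tendsto_natCast_atTop_atTop.atTop_div_const two_pos)))
    (fun n => by
      simp only [h.slope_add_int]
      rw [show f₁ (refTime k (n + 1) + x (n + 1) + m) = f₁ (refTime k (n + 1) + x (n + 1)) by
        simpa using h.periodic_deriv.int_mul m _]
      linear_combination hrec n)
  simpa only [launchVelocity, h.slope_add_int, add_sub_add_right_eq_sub] using key

/-- Initial data on a Lipschitz graph over the circle, through the common orbit, all of whose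
orbits are unbounded. -/
theorem IsRacket.exists_arc (h : IsRacket K f f₁ f₂) (hg : 0 < g)
    (hr : IsResonant g f f₁) (h0 : g / 4 ≤ f₂ 0) (h1 : g / 4 ≤ f₂ (5 / 12)) {vbar : ℝ}
    (hv₀ : g / 2 + 14 * K ≤ vbar) (hk : 2 ≤ k) (hkK : 96 * K ≤ g * (k - 1))
    (hkv : 2 * (vbar + K) < g * (k - 1)) :
    ∃ S : Set (UnitAddCircle × ℝ),
      IsArcThrough S (((0 : ℝ) : UnitAddCircle), g / 2 * (5 / 12 + (k : ℝ))) ∧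
      ∀ t v : ℝ, ((t : UnitAddCircle), v) ∈ S → IsUnboundedMotion g f vbar (t, v) := by
  have hK := h.nonneg
  -- `ρ ≤ 1/4` keeps the phases in one fundamental domain, `16 K ρ ≤ g` controls the remainder.
  obtain ⟨ρ, hρ0, hρ, hρK⟩ : ∃ ρ : ℝ, 0 < ρ ∧ ρ ≤ 1 / 4 ∧ 16 * K * ρ ≤ g := by
    refine ⟨min (1 / 4) (g / (16 * K + 1)), by positivity, min_le_left _ _, ?_⟩
    calc 16 * K * min (1 / 4) (g / (16 * K + 1)) ≤ (16 * K + 1) * (g / (16 * K + 1)) := by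
          gcongr
          · linarith
          · exact min_le_right _ _
      _ = g := by field_simp
  have hG := h.deviationMap_contracting hg h0 h1 hρ hρK hk hkK
  have hex : ∀ ξ : Icc (-1 : ℝ) 1, ∃ x : ℕ → ℝ, x 0 = ρ * ξ ∧ (∀ n, |x n| ≤ ρ) ∧
      ∀ n, x (n + 1) = deviationMap g f f₁ f₂ k n (x n) (x (n + 1)) (x (n + 2)) := by
    intro ξ
    refine exists_bounded_solution (by norm_num) (by norm_num) (h.deviationMap_zero hr) hG ?_
    rw [abs_mul, abs_of_pos hρ0]
    exact mul_le_of_le_one_right hρ0.le (abs_le.2 ξ.2)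
  choose X hX0 hXρ hXG using hex
  have hdist : ∀ ξ η n, |X ξ n - X η n| ≤ ρ * |(ξ : ℝ) - η| := by
    intro ξ η n
    have := abs_sub_le_of_recurrence (by norm_num) hG (hXρ ξ) (hXρ η) (hXG ξ) (hXG η) n
    rwa [hX0, hX0, ← mul_sub, abs_mul, abs_of_pos hρ0] at this
  let O : Icc (-1 : ℝ) 1 := ⟨0, by norm_num⟩
  have hXO : ∀ n, X O n = 0 := by
    intro n
    have := abs_sub_le_of_recurrence (y := fun _ => 0) (by norm_num) hG (hXρ O)
      (fun _ => by simpa using hρ0.le) (hXG O) (fun n => (h.deviationMap_zero hr n).symm) n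
    rw [hX0] at this
    simpa [O] using this
  let V : Icc (-1 : ℝ) 1 → ℝ := fun ξ =>
    launchVelocity g f (refTime k 0 + X ξ 0) (refTime k 1 + X ξ 1)
  have hcoord : ∀ n, Continuous fun ξ => X ξ n := fun n =>
    (LipschitzWith.of_dist_le_mul (K := ⟨ρ, hρ0.le⟩) fun ξ η => hdist ξ η n).continuous
  have hfc : Continuous f := continuous_iff_continuousAt.2 fun x => (h.hasDerivAt x).continuousAt
  have hVc : Continuous V := by
    have c0 := hcoord 0
    have c1 := hcoord 1
    have hne : ∀ ξ, (refTime k 1 + X ξ 1) - (refTime k 0 + X ξ 0) ≠ 0 := by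
      intro ξ
      have hk' : (2 : ℝ) ≤ k := by exact_mod_cast hk
      have := abs_le.1 (hXρ ξ 0)
      have := abs_le.1 (hXρ ξ 1)
      have := refTime_step k 0
      simp only [CharP.cast_eq_zero, zero_div, add_zero, zero_add] at this
      apply ne_of_gt
      linarith
    simp only [V, launchVelocity, slope_def_field]
    refine Continuous.add (by fun_prop) (Continuous.div (by fun_prop) (by fun_prop) hne)
  let γ : Icc (-1 : ℝ) 1 → UnitAddCircle × ℝ := fun ξ => (((ρ * ξ : ℝ) : UnitAddCircle), V ξ)
  have hγc : Continuous γ :=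
    ((AddCircle.continuous_mk' 1).comp (by fun_prop)).prodMk hVc
  have hγi : Function.Injective γ := by
    intro ξ η he
    have he' : ((ρ * ξ : ℝ) : UnitAddCircle) = ((ρ * η : ℝ) : UnitAddCircle) :=
      congrArg Prod.fst he
    -- All phases lie in one fundamental domain of the circle, since `ρ ≤ 1/4`.
    have hmem : ∀ ζ : Icc (-1 : ℝ) 1, ρ * ζ ∈ Ico (-1 / 2 : ℝ) (-1 / 2 + 1) := by
      rintro ⟨ζ, h₁, h₂⟩
      constructor <;> dsimp only <;> nlinarith
    exact Subtype.ext (mul_left_cancel₀ hρ0.ne'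
      ((AddCircle.coe_eq_coe_iff_of_mem_Ico (hmem ξ) (hmem η)).1 he'))
  refine ⟨range γ, ⟨γ, (hγc.isClosedEmbedding hγi).isEmbedding, rfl, ?_⟩, ?_⟩
  · have hs := h.slope_refTime hr k 0 1
    refine Prod.ext (by simp [γ]) ?_
    change V O = _
    simp only [V, hXO, launchVelocity, add_zero, hs]
    rw [refTime_one, refTime_zero, sub_zero]
  · rintro t v ⟨ξ, hξ⟩
    have ht : ((ρ * ξ : ℝ) : UnitAddCircle) = (t : UnitAddCircle) := congrArg Prod.fst hξ
    have hv : V ξ = v := congrArg Prod.snd hξ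
    -- The lift `t` of a point of the arc differs from `ρ ξ` by an integer `m`.
    obtain ⟨m, hm⟩ := (AddCircle.coe_eq_zero_iff 1 (x := t - ρ * ξ)).1
      (by rw [AddCircle.coe_sub, ht, sub_self])
    have hrec := fun n => h.recurrence_of_deviation hg hr h0 h1 (hXG ξ n)
    have key := (h.orbit_of_deviation hg hv₀ hρ hkv (hXρ ξ) m hrec).2
    have ht' : refTime k 0 + X ξ 0 + m = t := by
      rw [refTime_zero, hX0]
      simp only [zsmul_eq_mul, mul_one] at hm
      linarith
    rw [ht'] at key
    rw [← hv]
    exact key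

end Deviation

/-! ### Trigonometric polynomials of degree two -/

/-- The trigonometric polynomial of degree `2` without constant term with coefficients
`A, B, C, D`. -/
noncomputable def trigPoly (A B C D t : ℝ) : ℝ :=
  A * Real.sin (2 * Real.pi * t) + B * Real.cos (2 * Real.pi * t)
    + C * Real.sin (4 * Real.pi * t) + D * Real.cos (4 * Real.pi * t)

section TrigPoly

variable (A B C D t : ℝ)

theorem hasDerivAt_trigPoly : HasDerivAt (trigPoly A B C D)
    (trigPoly (-(2 * π * B)) (2 * π * A) (-(4 * π * D)) (4 * π * C) t) t := by
  have l : ∀ c : ℝ, HasDerivAt (fun t : ℝ => c * t) c t := fun c => by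
    simpa using (hasDerivAt_id t).const_mul c
  have h := (((l (2 * π)).sin.const_mul A).add ((l (2 * π)).cos.const_mul B)).add
    ((l (4 * π)).sin.const_mul C) |>.add ((l (4 * π)).cos.const_mul D)
  refine h.congr_deriv ?_
  unfold trigPoly
  ring

theorem trigPoly_periodic : Function.Periodic (trigPoly A B C D) 1 := by
  intro t
  have e1 : 2 * π * (t + 1) = 2 * π * t + 2 * π := by ring
  have e2 : 4 * π * (t + 1) = 4 * π * t + 2 * π + 2 * π := by ring
  simp only [trigPoly, e1, e2, Real.sin_add_two_pi, Real.cos_add_two_pi]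

theorem abs_trigPoly_le : |trigPoly A B C D t| ≤ |A| + |B| + |C| + |D| := by
  have hm : ∀ {x y : ℝ}, |y| ≤ 1 → |x * y| ≤ |x| := fun {x y} h => by
    rw [abs_mul]
    exact mul_le_of_le_one_right (abs_nonneg x) h
  unfold trigPoly
  refine (abs_add_le _ _).trans (add_le_add ((abs_add_le _ _).trans (add_le_add
    ((abs_add_le _ _).trans (add_le_add (hm ?_) (hm ?_))) (hm ?_))) (hm ?_))
  exacts [Real.abs_sin_le_one _, Real.abs_cos_le_one _, Real.abs_sin_le_one _,
    Real.abs_cos_le_one _]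

theorem trigPoly_zero : trigPoly A B C D 0 = B + D := by simp [trigPoly]

theorem trigPoly_node :
    trigPoly A B C D (5 / 12) = A / 2 - √3 / 2 * B - √3 / 2 * C + D / 2 := by
  have e1 : 2 * π * (5 / 12) = π - π / 6 := by ring
  have e2 : 4 * π * (5 / 12) = 2 * π - π / 3 := by ring
  simp only [trigPoly, e1, e2, Real.sin_pi_sub, Real.cos_pi_sub, Real.sin_two_pi_sub,
    Real.cos_two_pi_sub, Real.sin_pi_div_six, Real.cos_pi_div_six, Real.sin_pi_div_three,
    Real.cos_pi_div_three]
  ring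

variable {A B C D}

/-- Cauchy–Schwarz applied to each of the two harmonics separately. -/
theorem trigPoly_le_of_sq_le {r r' : ℝ} (hr : 0 ≤ r) (hr' : 0 ≤ r')
    (h : A ^ 2 + B ^ 2 ≤ r ^ 2) (h' : C ^ 2 + D ^ 2 ≤ r' ^ 2) : trigPoly A B C D t ≤ r + r' := by
  have key : ∀ {a b r : ℝ} (θ : ℝ), 0 ≤ r → a ^ 2 + b ^ 2 ≤ r ^ 2 →
      a * Real.sin θ + b * Real.cos θ ≤ r := by
    intro a b r θ hr h
    refine abs_le_of_sq_le_sq' ?_ hr |>.2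
    nlinarith [sq_nonneg (a * Real.cos θ - b * Real.sin θ), Real.sin_sq_add_cos_sq θ]
  have h1 := key (2 * π * t) hr h
  have h2 := key (4 * π * t) hr' h'
  unfold trigPoly
  linarith

end TrigPoly

/-- A trigonometric polynomial of degree two with coefficients of total size at most `L` is a
racket motion with the constant `(4π)³ L`: every derivative costs a factor of at most `4π`. -/
theorem isRacket_trigPoly {A B C D L : ℝ} (hL : |A| + |B| + |C| + |D| ≤ L) :
    IsRacket ((4 * π) ^ 3 * L) (trigPoly A B C D)
      (trigPoly (-(2 * π * B)) (2 * π * A) (-(4 * π * D)) (4 * π * C))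
      (trigPoly (-(2 * π * (2 * π * A))) (2 * π * -(2 * π * B)) (-(4 * π * (4 * π * C)))
        (4 * π * -(4 * π * D))) := by
  have hL0 : 0 ≤ L := le_trans (by positivity) hL
  have hπ : 1 ≤ 4 * π := by linarith [Real.pi_gt_three]
  have step : ∀ {A B C D M : ℝ}, |A| + |B| + |C| + |D| ≤ M →
      |-(2 * π * B)| + |2 * π * A| + |-(4 * π * D)| + |4 * π * C| ≤ 4 * π * M := by
    intro A B C D M hM
    have hp := Real.pi_pos
    simp only [abs_neg, abs_mul, abs_of_pos hp, abs_two, abs_of_pos (four_pos (α := ℝ))]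
    nlinarith [mul_nonneg hp.le (abs_nonneg A), mul_nonneg hp.le (abs_nonneg B),
      mul_le_mul_of_nonneg_left hM hp.le]
  have b1 := step hL
  have b2 := step b1
  have b3 := step b2
  have m1 : 4 * π * L ≤ (4 * π) ^ 3 * L := by
    gcongr
    exact le_self_pow₀ hπ (by norm_num)
  refine ⟨trigPoly_periodic _ _ _ _, trigPoly_periodic _ _ _ _, trigPoly_periodic _ _ _ _,
    hasDerivAt_trigPoly _ _ _ _, hasDerivAt_trigPoly _ _ _ _, fun t => ?_, fun t => ?_, ?_⟩
  · exact (abs_trigPoly_le _ _ _ _ t).trans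
      (hL.trans ((le_mul_of_one_le_left hL0 hπ).trans m1))
  · exact (abs_trigPoly_le _ _ _ _ t).trans (b1.trans m1)
  · refine abs_sub_le_of_hasDerivAt (hasDerivAt_trigPoly _ _ _ _) fun t => ?_
    refine (abs_trigPoly_le _ _ _ _ t).trans (b3.trans (le_of_eq ?_))
    ring

/-! ### The family -/

section Family

variable (g s : ℝ)

/-- The coefficient of `sin (2πt)` in the family. -/
noncomputable def coeffA : ℝ := g * s

/-- The coefficient of `cos (2πt)` in the family. -/
noncomputable def coeffB : ℝ := g * ((2 - √3) * s + (4 * √3 - 7) / (4 * π))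

/-- The coefficient of `sin (4πt)` in the family. -/
noncomputable def coeffC : ℝ := g * (5 / (96 * π) - s / 2)

/-- The coefficient of `cos (4πt)` in the family. -/
noncomputable def coeffD : ℝ := g * (√3 / 2 * s + (48 - 29 * √3) / (96 * π))

theorem family_eq_trigPoly :
    family g s = trigPoly (coeffA g s) (coeffB g s) (coeffC g s) (coeffD g s) := rfl

/-- The first derivative of the family. -/
noncomputable def familyDeriv : ℝ → ℝ :=
  trigPoly (-(2 * π * coeffB g s)) (2 * π * coeffA g s) (-(4 * π * coeffD g s))
    (4 * π * coeffC g s)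

/-- The second derivative of the family. -/
noncomputable def familyDeriv₂ : ℝ → ℝ :=
  trigPoly (-(2 * π * (2 * π * coeffA g s))) (2 * π * -(2 * π * coeffB g s))
    (-(4 * π * (4 * π * coeffC g s))) (4 * π * -(4 * π * coeffD g s))

/-- One constant serves all parameters of a bounded interval, because the coefficients are
continuous in `s`. -/
theorem exists_isRacket_family (a b : ℝ) :
    ∃ K, ∀ s ∈ Ioo a b, IsRacket K (family g s) (familyDeriv g s) (familyDeriv₂ g s) := by
  have hc : Continuous fun s => |coeffA g s| + |coeffB g s| + |coeffC g s| + |coeffD g s| := by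
    unfold coeffA coeffB coeffC coeffD
    fun_prop
  obtain ⟨L, hL⟩ := (isCompact_Icc (a := a) (b := b)).bddAbove_image hc.continuousOn
  exact ⟨(4 * π) ^ 3 * L, fun s hs =>
    isRacket_trigPoly (hL (mem_image_of_mem _ (Ioo_subset_Icc_self hs)))⟩

theorem isResonant_family : IsResonant g (family g s) (familyDeriv g s) := by
  have h3 : √3 ^ 2 = 3 := Real.sq_sqrt (by norm_num)
  have hπ := Real.pi_ne_zero
  constructor
  · rw [family_eq_trigPoly, trigPoly_node, trigPoly_zero]
    unfold coeffA coeffB coeffC coeffD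
    field_simp
    ring_nf
    rw [h3]
    ring
  · rw [familyDeriv, trigPoly_zero]
    unfold coeffA coeffC
    field_simp
    ring
  · rw [familyDeriv, trigPoly_node]
    unfold coeffA coeffB coeffC coeffD
    field_simp
    ring_nf
    rw [h3]
    ring

variable {g s}

theorem sqrt_three_bounds : 1.732 < √3 ∧ √3 < 1.7321 :=
  ⟨Real.lt_sqrt_of_sq_lt (by norm_num), (Real.sqrt_lt' (by norm_num)).2 (by norm_num)⟩

theorem familyDeriv₂_zero :
    familyDeriv₂ g s 0 = g * (π * ((5 * √3 - 6) / 6 - 4 * π * (2 + √3) * s)) := by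
  rw [familyDeriv₂, trigPoly_zero]
  unfold coeffB coeffD
  field_simp
  ring

theorem familyDeriv₂_node :
    familyDeriv₂ g s (5 / 12) = g * (π * (2 / 3 * (3 - √3) - 4 * π * (2 + √3) * s)) := by
  have h3 : √3 ^ 2 = 3 := Real.sq_sqrt (by norm_num)
  rw [familyDeriv₂, trigPoly_node]
  unfold coeffA coeffB coeffC coeffD
  field_simp
  ring_nf
  rw [h3]
  ring

/-- A numerical bound for the part of `f''` at the nodes that depends on `s`. -/
theorem four_pi_mul_le (hs : s ≤ 0.006) : 4 * π * (2 + √3) * s ≤ 0.3 := by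
  have h2 := sqrt_three_bounds.2
  have hπ := Real.pi_lt_d2
  calc 4 * π * (2 + √3) * s ≤ 4 * π * (2 + √3) * 0.006 := by gcongr
    _ ≤ 4 * 3.15 * (2 + 1.7321) * 0.006 := by gcongr
    _ ≤ 0.3 := by norm_num

theorem div_four_le_mul_pi_mul {x : ℝ} (hg : 0 < g) (hx : 0.1 ≤ x) : g / 4 ≤ g * (π * x) := by
  have := Real.pi_gt_three
  have : 3 * 0.1 ≤ π * x := by gcongr
  nlinarith

theorem le_familyDeriv₂_zero (hg : 0 < g) (hs : s ≤ 0.006) : g / 4 ≤ familyDeriv₂ g s 0 := by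
  rw [familyDeriv₂_zero]
  refine div_four_le_mul_pi_mul hg ?_
  linarith [four_pi_mul_le hs, sqrt_three_bounds.1]

theorem le_familyDeriv₂_node (hg : 0 < g) (hs : s ≤ 0.006) :
    g / 4 ≤ familyDeriv₂ g s (5 / 12) := by
  rw [familyDeriv₂_node]
  refine div_four_le_mul_pi_mul hg ?_
  linarith [four_pi_mul_le hs, sqrt_three_bounds.2]

/-- At `s = 0.006` the two harmonics of `p_s' / g` have amplitudes below `0.05` and `0.175`, hence
below `0.06` and `0.18`, whose sum is less than `1/4`. These conditions are open in `s`. -/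
theorem exists_isParameterInterval (hg : 0 < g) : ∃ a b : ℝ, IsParameterInterval g a b := by
  let U : Set ℝ := {s | (-(2 * π * coeffB 1 s)) ^ 2 + (2 * π * coeffA 1 s) ^ 2 < 0.06 ^ 2 ∧
    (-(4 * π * coeffD 1 s)) ^ 2 + (4 * π * coeffC 1 s) ^ 2 < 0.18 ^ 2 ∧ 0 < s}
  have hU : IsOpen U := by
    simp only [U, ofPred_and, coeffA, coeffB, coeffC, coeffD]
    exact (isOpen_lt (by fun_prop) (by fun_prop)).inter
      ((isOpen_lt (by fun_prop) (by fun_prop)).inter (isOpen_lt (by fun_prop) (by fun_prop)))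
  -- Interval arithmetic with two decimals of `π` and four of `√3`.
  have hmem : (0.006 : ℝ) ∈ U := by
    obtain ⟨h1, h2⟩ := sqrt_three_bounds
    have p1 := Real.pi_gt_d2
    have p2 := Real.pi_lt_d2
    have hπ := Real.pi_ne_zero
    have eA : 2 * π * coeffA 1 0.006 = 0.012 * π := by
      unfold coeffA
      ring
    have eB : -(2 * π * coeffB 1 0.006) = (7 - 4 * √3) / 2 - 0.012 * (π * (2 - √3)) := by
      unfold coeffB
      field_simp
      ring
    have eC : 4 * π * coeffC 1 0.006 = 5 / 24 - 0.012 * π := by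
      unfold coeffC
      field_simp
      ring
    have eD : -(4 * π * coeffD 1 0.006) = (29 * √3 - 48) / 24 - 0.012 * (π * √3) := by
      unfold coeffD
      field_simp
      ring
    have q1 : 3.14 * 0.2679 ≤ π * (2 - √3) := by gcongr; linarith
    have q2 : π * (2 - √3) ≤ 3.15 * 0.268 := by gcongr <;> linarith
    have q3 : 3.14 * 1.732 ≤ π * √3 := by gcongr
    have q4 : π * √3 ≤ 3.15 * 1.7321 := by gcongr
    refine ⟨?_, ?_, by norm_num⟩
    · rw [eA, eB]
      calc _ ≤ (0.03 : ℝ) ^ 2 + 0.04 ^ 2 := by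
            refine add_le_add (sq_le_sq' ?_ ?_) (sq_le_sq' ?_ ?_) <;> linarith
        _ < _ := by norm_num
    · rw [eC, eD]
      calc _ ≤ (0.03 : ℝ) ^ 2 + 0.172 ^ 2 := by
            refine add_le_add (sq_le_sq' ?_ ?_) (sq_le_sq' ?_ ?_) <;> linarith
        _ < _ := by norm_num
  obtain ⟨ε, hε, hball⟩ := Metric.isOpen_iff.1 hU _ hmem
  rw [Real.ball_eq_Ioo] at hball
  refine ⟨0.006 - ε, 0.006 + ε, ⟨by linarith, by linarith⟩,
    fun h => lt_irrefl _ (hball h).2.2, fun s hs t => ?_⟩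
  obtain ⟨hs1, hs2, -⟩ := hball hs
  have hle := trigPoly_le_of_sq_le t (by norm_num) (by norm_num) hs1.le hs2.le
  rw [family_eq_trigPoly, (hasDerivAt_trigPoly _ _ _ _ t).deriv]
  have e : trigPoly (-(2 * π * coeffB g s)) (2 * π * coeffA g s) (-(4 * π * coeffD g s))
      (4 * π * coeffC g s) t = g * trigPoly (-(2 * π * coeffB 1 s)) (2 * π * coeffA 1 s)
      (-(4 * π * coeffD 1 s)) (4 * π * coeffC 1 s) t := by
    unfold trigPoly coeffA coeffB coeffC coeffD
    ring
  rw [e]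
  nlinarith

end Family

/-! ### The common orbit and the arcs for the family -/

/-- The common orbit: the reference times with the corresponding velocities. -/
noncomputable def refOrbit (g : ℝ) (k n : ℕ) : ℝ × ℝ :=
  (refTime k n, g / 2 * (refTime k (n + 1) - refTime k n))

theorem IsRacket.refOrbit_spec {g K vbar : ℝ} {f f₁ f₂ : ℝ → ℝ} {k : ℕ}
    (h : IsRacket K f f₁ f₂) (hg : 0 < g) (hr : IsResonant g f f₁)
    (hv₀ : g / 2 + 14 * K ≤ vbar) (hkv : 2 * (vbar + K) < g * (k - 1)) :
    (∀ n, (bounceMap g f)^[n] (refOrbit g k 0) = refOrbit g k n) ∧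
      IsUnboundedMotion g f vbar (refOrbit g k 0) := by
  have hs := h.slope_refTime hr k
  -- The common orbit is the case of zero deviations.
  have key := h.orbit_of_deviation (ρ := 0) hg hv₀ (by norm_num) hkv (x := fun _ => 0)
    (by simp) 0 (fun n => by simpa [hs] using h.refTime_recurrence hr k n)
  simp only [launchVelocity, add_zero, hs, Int.cast_zero] at key
  exact key

end BouncingBall

open BouncingBall in
theorem mainTheorem6 (g : ℝ) (hg : 0 < g) :
    (∃ a b : ℝ, BouncingBall.IsParameterInterval g a b) ∧
    ∀ a b : ℝ, BouncingBall.IsParameterInterval g a b →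
      ∃ a' b' : ℝ, a' < b' ∧ Set.Ioo a' b' ⊆ Set.Ioo a b ∧
      ∃ v₀ : ℝ, ∀ vbar : ℝ, v₀ ≤ vbar →
        -- the maps are well defined on the half cylinder of velocities above `vbar`
        (∀ s ∈ Set.Ioo a b,
          BouncingBall.WellDefinedAbove g (BouncingBall.family g s) vbar) ∧
        ∃ T : ℝ, ∀ k : ℕ, 0 < k → T < (k : ℝ) →
          ∃ z : ℕ → ℝ × ℝ,
            -- the common unbounded orbit, independent of the parameter
            z 0 = (0, g / 2 * (5 / 12 + (k : ℝ))) ∧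
            (z 1).1 = 5 / 12 + (k : ℝ) ∧
            (∀ n : ℕ, ∃ σ : ℕ, 0 < σ ∧ (z (n + 2)).1 = (z n).1 + (σ : ℝ)) ∧
            (∀ n : ℕ, (z (n + 2)).2 = (z n).2 + g / 2) ∧
            (∀ s ∈ Set.Ioo a b,
              (∀ n : ℕ, (BouncingBall.bounceMap g (BouncingBall.family g s))^[n] (z 0) = z n) ∧
              BouncingBall.IsUnboundedMotion g (BouncingBall.family g s) vbar (z 0)) ∧
            -- the continua of initial data, all passing through the common orbit
            ∀ s ∈ Set.Ioo a' b', ∃ S : Set (UnitAddCircle × ℝ),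
              BouncingBall.IsArcThrough S (((z 0).1 : UnitAddCircle), (z 0).2) ∧
              ∀ t v : ℝ, ((t : UnitAddCircle), v) ∈ S →
                BouncingBall.IsUnboundedMotion g (BouncingBall.family g s) vbar (t, v) := by
  refine ⟨exists_isParameterInterval hg, fun a b hab => ?_⟩
  obtain ⟨K, hK⟩ := exists_isRacket_family g a b
  have hsub : Ioo a 0.006 ⊆ Ioo a b := Ioo_subset_Ioo_right hab.1.2.le
  refine ⟨a, 0.006, hab.1.1, hsub, g / 2 + 14 * K, fun vbar hv₀ =>
    ⟨fun s hs => (hK s hs).wellDefinedAbove hg hv₀,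
      max 2 (1 + max (96 * K) (2 * (vbar + K)) / g), fun k _ hkT => ?_⟩⟩
  -- The threshold makes `g (k - 1)` exceed both `96 K` (contraction) and `2 (vbar + K)` (velocities
  -- above `vbar`).
  obtain ⟨hk2, hkT⟩ := max_lt_iff.1 hkT
  have hk : 2 ≤ k := by exact_mod_cast hk2.le
  obtain ⟨hkK, hkv⟩ := max_lt_iff.1 ((div_lt_iff₀' hg).1 (lt_sub_iff_add_lt'.2 hkT))
  have hz0 : refOrbit g k 0 = (0, g / 2 * (5 / 12 + (k : ℝ))) := by
    simp [refOrbit, refTime_zero, refTime_one]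
  refine ⟨refOrbit g k, hz0, refTime_one k, fun n => ⟨n + 1 + 2 * k, by omega,
    refTime_add_two k n⟩, fun n => ?_,
    fun s hs => (hK s hs).refOrbit_spec hg (isResonant_family g s) hv₀ hkv, fun s hs => ?_⟩
  · change g / 2 * (refTime k (n + 1 + 2) - refTime k (n + 2)) = _
    rw [refTime_add_two, refTime_add_two, refOrbit]
    push_cast
    ring
  · rw [hz0]
    exact (hK s (hsub hs)).exists_arc hg (isResonant_family g s)
      (le_familyDeriv₂_zero hg hs.2.le) (le_familyDeriv₂_node hg hs.2.le) hv₀ hk hkK.le hkv
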